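/- Let $n\ge 0$, $q\ge 2$, $m_{\rm d},m_{\rm r}\ge 0$ be integers. Let $M,K\in\mathbb{R}^{n\times n}$ be symmetric positive definite, and suppose that the roots of the polynomial $\det(sM-K)$ are distinct. Let $C_{\rm d}\in\mathbb{R}^{m_{\rm d}\times n}$ and $C_{\rm r}\in\mathbb{R}^{m_{\rm r}\times n}$, and let $d_{ij},r_{ij}\ge 0$ $(i,j=1,\dots,q)$ be real scalars with $d_{ij}=d_{ji}$, $r_{ij}=r_{ji}$, $d_{ii}=r_{ii}=0$. For $\varepsilon>0$ consider the array of coupled oscillators $$M\ddot x_i+Kx_i+\sum_{j=1}^{q}d_{ij}C_{\rm d}^{T}C_{\rm d}(\dot x_i-\dot x_j)+\varepsilon\sum_{j=1}^{q}r_{ij}C_{\rm r}^{T}C_{\rm r}(x_i-x_j)=0,\qquad i=1,\dots,q,\qquad(\ast)$$ with $x_i(t)\in\mathbb{R}^n$, $t\ge 0$. The array $(\ast)$ is said to synchronize if for every solution (i.e. for all initial conditions) $\|x_i(t)-x_j(t)\|\to 0$ as $t\to\infty$ for all $i,j$. Let $\ell_{\rm d},\ell_{\rm r}\in\mathbb{R}^{q\times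 q}$ be the Laplacian matrices of the weights $(d_{ij})$ and $(r_{ij})$: the diagonal entries are $(\ell_{\rm d})_{ii}=\sum_{k}d_{ik}$ and the off-diagonal entries are $(\ell_{\rm d})_{ij}=-d_{ij}$, and likewise for $\ell_{\rm r}$ and $(r_{ij})$. For $X\in\mathbb{C}^{q\times q}$ let $\lambda_1(X),\dots,\lambda_q(X)$ be its eigenvalues, repeated according to algebraic multiplicity and ordered so that $\mathrm{Re}\,\lambda_1(X)\le\cdots\le\mathrm{Re}\,\lambda_q(X)$. A pair $(C,A)$ is called observable if, for the system $\dot z=Az$, $y=Cz$, two solutions with the same output $y(t)$ for all $t\ge 0$ have the same initial state $z(0)$. Let $j$ in $\ell_{\rm d}+j\ell_{\rm r}$ denote the imaginary unit. Suppose $\mathrm{Re}\,\lambda_2(\ell_{\rm d}+j\ell_{\rm r})>0$ and that both $(C_{\rm d},M^{-1}K)$ and $(C_{\rm r},M^{-1}K)$ are observable pairs. Then there exists $\rho>0$ such that the array $(\ast)$ synchronizes for all $\varepsilon\in(0,\rho)$. -/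

import Mathlib

open Matrix

noncomputable section

/-- A trajectory `x t i` (state of oscillator `i` at time `t ≥ 0`), with velocities `v` and
accelerations `a`, solves on `[0, ∞)` the array
`M ẍᵢ + K xᵢ + ∑ⱼ Dᵢⱼ (ẋᵢ - ẋⱼ) + ∑ⱼ Rᵢⱼ (xᵢ - xⱼ) = 0`, `i = 1, …, q`. -/
structure IsArraySolution {n q : ℕ} (M K : Matrix (Fin n) (Fin n) ℝ)
    (D R : Fin q → Fin q → Matrix (Fin n) (Fin n) ℝ)
    (x v a : ℝ → Fin q → Fin n → ℝ) : Prop where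
  hasDeriv_pos : ∀ t, 0 ≤ t → HasDerivWithinAt x (v t) (Set.Ici 0) t
  hasDeriv_vel : ∀ t, 0 ≤ t → HasDerivWithinAt v (a t) (Set.Ici 0) t
  equation : ∀ t, 0 ≤ t → ∀ i,
    M *ᵥ a t i + K *ᵥ x t i + ∑ j, D i j *ᵥ (v t i - v t j)
      + ∑ j, R i j *ᵥ (x t i - x t j) = 0

/-- The array synchronizes: along every solution (that is, for all initial conditions),
the Euclidean distance `‖xᵢ(t) - xⱼ(t)‖` tends to `0` as `t → ∞`, for all `i, j`. -/
def Synchronizes {n q : ℕ} (M K : Matrix (Fin n) (Fin n) ℝ)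
    (D R : Fin q → Fin q → Matrix (Fin n) (Fin n) ℝ) : Prop :=
  ∀ x v a : ℝ → Fin q → Fin n → ℝ, IsArraySolution M K D R x v a →
    ∀ i j, Filter.Tendsto (fun t => ‖WithLp.toLp 2 (x t i - x t j)‖) Filter.atTop (nhds 0)

/-- The scalar-weighted Laplacian `lap (wᵢⱼ)`: diagonal entries `∑ⱼ wᵢⱼ`, off-diagonal
entries `-wᵢⱼ`. -/
def lap {q : ℕ} (w : Fin q → Fin q → ℝ) : Matrix (Fin q) (Fin q) ℝ :=
  Matrix.of fun i j => if i = j then ∑ k, w i k else -w i j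

/-- The real parts of the eigenvalues of `X`, counted with algebraic multiplicity, in
nondecreasing order. -/
def sortedReEigenvalues {m : ℕ} (X : Matrix (Fin m) (Fin m) ℂ) : List ℝ :=
  (X.charpoly.roots.map Complex.re).sort (· ≤ ·)

theorem length_sortedReEigenvalues {m : ℕ} (X : Matrix (Fin m) (Fin m) ℂ) :
    (sortedReEigenvalues X).length = m := by
  rw [sortedReEigenvalues, Multiset.length_sort, Multiset.card_map,
    IsAlgClosed.card_roots_eq_natDegree, Matrix.charpoly_natDegree_eq_dim, Fintype.card_fin]

/-- `reEigenvalue X k` is `Re λₖ₊₁(X)` (the index `k` starts at `0`), where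
`λ₁(X), …, λₘ(X)` are the eigenvalues of `X`, repeated according to multiplicity and ordered
by nondecreasing real part. -/
def reEigenvalue {m : ℕ} (X : Matrix (Fin m) (Fin m) ℂ) (k : Fin m) : ℝ :=
  (sortedReEigenvalues X).get (k.cast (length_sortedReEigenvalues X).symm)

/-- The complex matrix `X + jY` built from two real matrices. -/
def complexCombine {m : ℕ} (X Y : Matrix (Fin m) (Fin m) ℝ) : Matrix (Fin m) (Fin m) ℂ :=
  X.map (fun s : ℝ => (s : ℂ)) + Complex.I • Y.map (fun s : ℝ => (s : ℂ))

/-- `z` solves `ż = A z` on `[0, ∞)`. -/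
def IsLinearTrajectory {n : ℕ} (A : Matrix (Fin n) (Fin n) ℝ) (z : ℝ → Fin n → ℝ) : Prop :=
  ∀ t, 0 ≤ t → HasDerivWithinAt z (A *ᵥ z t) (Set.Ici 0) t

/-- The pair `(C, A)` is observable: for the system `ż = A z`, `y = C z`, the output determines
the initial state. -/
def IsObservablePair {m n : ℕ} (C : Matrix (Fin m) (Fin n) ℝ)
    (A : Matrix (Fin n) (Fin n) ℝ) : Prop :=
  ∀ z w : ℝ → Fin n → ℝ, IsLinearTrajectory A z → IsLinearTrajectory A w →
    (∀ t, 0 ≤ t → C *ᵥ z t = C *ᵥ w t) → z 0 = w 0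

/-- The polynomial `d(s) = det (s M - K)`, whose roots are the eigenvalues of `K` with respect
to `M`. -/
def pencilPoly {n : ℕ} (M K : Matrix (Fin n) (Fin n) ℝ) : Polynomial ℝ :=
  ((Polynomial.X : Polynomial ℝ) • M.map Polynomial.C - K.map Polynomial.C).det

end

/-!
The deviations of the oscillators from their mean, stacked into one vector, solve
`M ẍ + D ẋ + K x = 0` with `M`, `K` positive definite and `D` positive semidefinite. Pairing the
eigenvector equation with the eigenvector gives a scalar quadratic, from which the system decays as
soon as no vibration mode of `M ẍ + K x = 0` lies in the kernel of `D`.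

Suppose such invisible modes existed for arbitrarily small `ε`. Normalized, they accumulate at an
invisible mode for `ε = 0`, which has the form `γ ⊗ v` because the pencil `s M - K` has simple
roots. Observability of `C_d` gives `ℓ_d γ = 0`, while first-order perturbation theory and
observability of `C_r` give `ℓ_r γ = ν γ` with `ν` real. Besides the eigenvalue `0` with the
constant eigenvector, `ℓ_d + j ℓ_r` then has the eigenvalue `j ν`, contradicting `Re λ₂ > 0`.
-/

open Filter Set Function
open scoped Topology Kronecker ComplexOrder

section LinearStability

variable {E : Type*} [NormedAddCommGroup E] [NormedSpace ℂ E]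

theorem hasDerivWithinAt_cexp_neg_smul {l : ℂ} {y : ℝ → E} {f : E} {s : Set ℝ} {t : ℝ}
    (hy : HasDerivWithinAt y (l • y t + f) s t) :
    HasDerivWithinAt (fun t : ℝ => Complex.exp (-(l * t)) • y t) (Complex.exp (-(l * t)) • f)
      s t := by
  have h : HasDerivAt (fun t : ℝ => Complex.exp (-(l * t))) (Complex.exp (-(l * t)) * -l) t := by
    simpa using (((hasDerivAt_id t).ofReal_comp.const_mul l).neg).cexp
  refine (h.hasDerivWithinAt.smul hy).congr_deriv ?_
  module

theorem norm_le_of_hasDerivWithinAt_smul_add {l : ℂ} (hl : l.re < 0) {y f : ℝ → E} {T δ : ℝ}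
    (hy : ∀ t, T ≤ t → HasDerivWithinAt y (l • y t + f t) (Ici T) t)
    (hf : ∀ t, T ≤ t → ‖f t‖ ≤ δ) {t : ℝ} (ht : T ≤ t) :
    ‖y t‖ ≤ Real.exp (l.re * (t - T)) * ‖y T‖ + δ / -l.re := by
  have hexp (s : ℝ) : ‖Complex.exp (-(l * s))‖ = Real.exp (-(l.re * s)) := by
    simp [Complex.norm_exp]
  have hderiv (s : ℝ) (hs : T ≤ s) := hasDerivWithinAt_cexp_neg_smul (hy s hs)
  have hbound : ‖Complex.exp (-(l * t)) • y t‖ ≤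
      Real.exp (-(l.re * T)) * ‖y T‖ + δ / -l.re * Real.exp (-(l.re * t)) := by
    refine image_norm_le_of_norm_deriv_right_le_deriv_boundary (a := T) (b := t)
      (f := fun s : ℝ => Complex.exp (-(l * s)) • y s)
      (f' := fun s => Complex.exp (-(l * s)) • f s)
      (B := fun s => Real.exp (-(l.re * T)) * ‖y T‖ + δ / -l.re * Real.exp (-(l.re * s)))
      (B' := fun s => δ * Real.exp (-(l.re * s)))
      (fun s hs => (hderiv s hs.1).continuousWithinAt.mono Icc_subset_Ici_self)
      (fun s hs => (hderiv s hs.1).mono (Ici_subset_Ici.2 hs.1)) ?_ (fun s => ?_) (fun s hs => ?_)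
      (right_mem_Icc.2 ht)
    · have hδ : 0 ≤ δ := (norm_nonneg _).trans (hf T le_rfl)
      rw [norm_smul, hexp]
      exact le_add_of_nonneg_right
        (mul_nonneg (div_nonneg hδ (neg_nonneg.2 hl.le)) (Real.exp_pos _).le)
    · have h : HasDerivAt (fun s => Real.exp (-(l.re * s))) (Real.exp (-(l.re * s)) * -l.re) s := by
        simpa using (((hasDerivAt_id s).const_mul l.re).neg).exp
      refine ((h.const_mul (δ / -l.re)).const_add _).congr_deriv ?_
      field_simp [hl.ne]
    · rw [norm_smul, hexp, mul_comm]
      gcongr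
      exact hf s hs.1
  rw [norm_smul, hexp] at hbound
  calc ‖y t‖ = Real.exp (l.re * t) * (Real.exp (-(l.re * t)) * ‖y t‖) := by
        rw [← mul_assoc, ← Real.exp_add, add_neg_cancel, Real.exp_zero, one_mul]
    _ ≤ Real.exp (l.re * t) *
        (Real.exp (-(l.re * T)) * ‖y T‖ + δ / -l.re * Real.exp (-(l.re * t))) := by gcongr
    _ = Real.exp (l.re * t + -(l.re * T)) * ‖y T‖ +
        δ / -l.re * Real.exp (l.re * t + -(l.re * t)) := by
      rw [Real.exp_add, Real.exp_add]
      ring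
    _ = Real.exp (l.re * (t - T)) * ‖y T‖ + δ / -l.re := by
      rw [add_neg_cancel, Real.exp_zero, mul_one, mul_sub, sub_eq_add_neg]

theorem tendsto_zero_of_hasDerivWithinAt_smul_add {l : ℂ} (hl : l.re < 0) {y f : ℝ → E}
    (hy : ∀ t, 0 ≤ t → HasDerivWithinAt y (l • y t + f t) (Ici 0) t)
    (hf : Tendsto f atTop (𝓝 0)) : Tendsto y atTop (𝓝 0) := by
  rw [NormedAddGroup.tendsto_nhds_zero] at hf ⊢
  intro ε hε
  have hδ : 0 < ε / 2 * -l.re := mul_pos (half_pos hε) (neg_pos.2 hl)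
  obtain ⟨T, hT⟩ := eventually_atTop.1 ((hf _ hδ).and (eventually_ge_atTop 0))
  have hT0 : 0 ≤ T := (hT T le_rfl).2
  have hdecay : Tendsto (fun t => Real.exp (l.re * (t - T)) * ‖y T‖) atTop (𝓝 0) := by
    have h : Tendsto (fun t => l.re * (t - T)) atTop atBot :=
      (tendsto_atTop_add_const_right _ (-T) tendsto_id).const_mul_atTop_of_neg hl
    simpa using (Real.tendsto_exp_atBot.comp h).mul_const ‖y T‖
  filter_upwards [hdecay.eventually_lt_const (half_pos hε), eventually_ge_atTop T] with t hlt ht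
  have hle := norm_le_of_hasDerivWithinAt_smul_add hl
    (fun s hs => (hy s (hT0.trans hs)).mono (Ici_subset_Ici.2 hT0)) (fun s hs => (hT s hs).1.le) ht
  rw [mul_div_cancel_right₀ _ (neg_ne_zero.2 hl.ne)] at hle
  linarith

variable [FiniteDimensional ℂ E] {A : Module.End ℂ E} {y : ℝ → E}

/- The roots are peeled off one at a time: `z = (A - l) y` is again a trajectory of `A`,
and `y' = l y + z`. -/
theorem tendsto_zero_of_tendsto_aeval_prod_X_sub_C {s : Multiset ℂ} (hs : ∀ l ∈ s, l.re < 0)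
    (hy : ∀ t, 0 ≤ t → HasDerivWithinAt y (A (y t)) (Ici 0) t)
    (hlim : Tendsto
      (fun t => Polynomial.aeval A (s.map fun l => Polynomial.X - Polynomial.C l).prod (y t))
      atTop (𝓝 0)) :
    Tendsto y atTop (𝓝 0) := by
  induction s using Multiset.induction_on generalizing y with
  | empty => simpa using hlim
  | cons l s ih =>
    rw [Multiset.forall_mem_cons] at hs
    have hz : Tendsto (fun t => (A - algebraMap ℂ _ l) (y t)) atTop (𝓝 0) := by
      refine ih hs.2 (fun t ht => ?_) ?_
      · refine (((LinearMap.toContinuousLinearMap (A - algebraMap ℂ _ l)).restrictScalars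
          ℝ).hasFDerivAt.comp_hasDerivWithinAt t (hy t ht)).congr_deriv ?_
        simp
      · simpa [mul_comm (Polynomial.X - Polynomial.C l)] using hlim
    refine tendsto_zero_of_hasDerivWithinAt_smul_add hs.1 (fun t ht => ?_) hz
    simpa using hy t ht

theorem tendsto_zero_of_forall_hasEigenvalue_re_neg (hA : ∀ l, A.HasEigenvalue l → l.re < 0)
    (hy : ∀ t, 0 ≤ t → HasDerivWithinAt y (A (y t)) (Ici 0) t) : Tendsto y atTop (𝓝 0) := by
  refine tendsto_zero_of_tendsto_aeval_prod_X_sub_C (s := A.charpoly.roots) (fun l hl => hA l ?_)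
    hy ?_
  · exact (A.hasEigenvalue_iff_isRoot_charpoly l).2 (Polynomial.isRoot_of_mem_roots hl)
  · rw [← (IsAlgClosed.splits A.charpoly).eq_prod_roots_of_monic A.charpoly_monic,
      LinearMap.aeval_self_charpoly]
    simp

end LinearStability

open scoped MatrixOrder in
theorem posSemidef_map_ofReal {N : Type*} [Finite N] {A : Matrix N N ℝ} (hA : A.PosSemidef) :
    (A.map ((↑) : ℝ → ℂ)).PosSemidef := by
  classical
  have := Fintype.ofFinite N
  obtain ⟨B, rfl⟩ := CStarAlgebra.nonneg_iff_eq_star_mul_self.mp hA.nonneg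
  have h : (star B * B).map ((↑) : ℝ → ℂ) = (B.map (↑))ᴴ * B.map (↑) := by
    ext i j
    simp [mul_apply, star_eq_conjTranspose]
  rw [h]
  exact posSemidef_conjTranspose_mul_self _

theorem posDef_map_ofReal {N : Type*} [Finite N] {A : Matrix N N ℝ} (hA : A.PosDef) :
    (A.map ((↑) : ℝ → ℂ)).PosDef := by
  classical
  have := Fintype.ofFinite N
  refine (posSemidef_map_ofReal hA.posSemidef).posDef_iff_isUnit.2 ?_
  exact hA.isUnit.map (algebraMap ℝ ℂ).mapMatrix

section PervasiveDamping

variable {N : Type*} [Fintype N]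

/-- The damping `D` of the second-order system `M ẍ + D ẋ + K x = 0` is pervasive, in the sense of
mechanics: no vibration mode `u ≠ 0` of the undamped system `M ẍ + K x = 0` is invisible to `D`. -/
def IsPervasivelyDamped {𝕜 : Type*} [RCLike 𝕜] (M D K : Matrix N N 𝕜) : Prop :=
  ∀ (u : N → 𝕜) (μ : ℝ), K *ᵥ u = μ • (M *ᵥ u) → D *ᵥ u = 0 → u = 0

theorem re_neg_of_quadratic {m d k : ℝ} {l : ℂ} (hm : 0 < m) (hd : 0 < d) (hk : 0 < k)
    (h : l ^ 2 * m + l * d + k = 0) : l.re < 0 := by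
  have hre : (l.re ^ 2 - l.im ^ 2) * m + l.re * d + k = 0 := by
    simpa [pow_two] using congrArg Complex.re h
  have him : l.im * (2 * l.re * m + d) = 0 := by
    have h' := congrArg Complex.im h
    simp only [pow_two, Complex.add_im, Complex.mul_im, Complex.mul_re, Complex.ofReal_im,
      mul_zero, Complex.ofReal_re, zero_add, add_zero, Complex.zero_im] at h'
    linarith
  rcases mul_eq_zero.1 him with him | him
  · rw [him] at hre
    by_contra! hl
    have : 0 ≤ l.re ^ 2 * m := by positivity
    have : 0 ≤ l.re * d := by positivity
    nlinarith
  · by_contra! hl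
    have : 0 ≤ 2 * l.re * m := by positivity
    linarith

/- Pairing the equation with `u` gives a scalar quadratic in `l`. -/
theorem re_neg_of_quadratic_mulVec_eq_zero {M D K : Matrix N N ℂ} (hM : M.PosDef)
    (hD : D.PosSemidef) (hK : K.PosDef) (hdamp : IsPervasivelyDamped M D K) {u : N → ℂ}
    (hu : u ≠ 0) {l : ℂ} (h : l ^ 2 • (M *ᵥ u) + l • (D *ᵥ u) + K *ᵥ u = 0) : l.re < 0 := by
  obtain ⟨m, hm, hmu⟩ : ∃ m : ℝ, 0 < m ∧ (m : ℂ) = star u ⬝ᵥ M *ᵥ u :=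
    RCLike.pos_iff_exists_ofReal.1 (hM.dotProduct_mulVec_pos hu)
  obtain ⟨k, hk, hku⟩ : ∃ k : ℝ, 0 < k ∧ (k : ℂ) = star u ⬝ᵥ K *ᵥ u :=
    RCLike.pos_iff_exists_ofReal.1 (hK.dotProduct_mulVec_pos hu)
  obtain ⟨d, hd, hdu⟩ : ∃ d : ℝ, 0 ≤ d ∧ (d : ℂ) = star u ⬝ᵥ D *ᵥ u :=
    RCLike.nonneg_iff_exists_ofReal.1 (hD.dotProduct_mulVec_nonneg u)
  have hquad : l ^ 2 * m + l * d + k = 0 := by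
    simpa only [dotProduct_add, dotProduct_smul, smul_eq_mul, ← hmu, ← hku, ← hdu,
      dotProduct_zero] using congrArg (star u ⬝ᵥ ·) h
  rcases hd.eq_or_lt with rfl | hd
  · have hDu : D *ᵥ u = 0 := (hD.dotProduct_mulVec_zero_iff u).1 (by simpa using hdu.symm)
    have hl : l ^ 2 = -((k / m : ℝ) : ℂ) := by
      have hm' : (m : ℂ) ≠ 0 := by exact_mod_cast hm.ne'
      push_cast
      field_simp
      simpa [eq_neg_iff_add_eq_zero] using hquad
    refine absurd (hdamp u (k / m) ?_ hDu) hu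
    rw [hDu, smul_zero, add_zero, hl, neg_smul, neg_add_eq_zero] at h
    rw [← h, ← Complex.coe_smul]
  · exact re_neg_of_quadratic hm hd hk hquad

theorem map_ofReal_mulVec_re (A : Matrix N N ℝ) (u : N → ℂ) (i : N) :
    ((A.map ((↑) : ℝ → ℂ) *ᵥ u) i).re = (A *ᵥ fun j => (u j).re) i := by
  simp [mulVec, dotProduct]

theorem map_ofReal_mulVec_im (A : Matrix N N ℝ) (u : N → ℂ) (i : N) :
    ((A.map ((↑) : ℝ → ℂ) *ᵥ u) i).im = (A *ᵥ fun j => (u j).im) i := by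
  simp [mulVec, dotProduct]

theorem IsPervasivelyDamped.map_ofReal {M D K : Matrix N N ℝ} (h : IsPervasivelyDamped M D K) :
    IsPervasivelyDamped (M.map ((↑) : ℝ → ℂ)) (D.map (↑)) (K.map (↑)) := by
  intro u μ hK hD
  have hre : (fun i => (u i).re) = 0 := by
    refine h _ μ (funext fun i => ?_) (funext fun i => ?_)
    · simpa [map_ofReal_mulVec_re] using congrArg Complex.re (congrFun hK i)
    · simpa [map_ofReal_mulVec_re] using congrArg Complex.re (congrFun hD i)
  have him : (fun i => (u i).im) = 0 := by
    refine h _ μ (funext fun i => ?_) (funext fun i => ?_)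
    · simpa [map_ofReal_mulVec_im] using congrArg Complex.im (congrFun hK i)
    · simpa [map_ofReal_mulVec_im] using congrArg Complex.im (congrFun hD i)
  exact funext fun i => Complex.ext (congrFun hre i) (congrFun him i)

section FirstOrderGenerator

variable [DecidableEq N]

/-- The generator `(x, v) ↦ (v, -M⁻¹ (K x + D v))` of the first-order system equivalent to
`M ẍ + D ẋ + K x = 0`. -/
noncomputable def firstOrderGenerator (M D K : Matrix N N ℂ) : Module.End ℂ ((N → ℂ) × (N → ℂ)) :=
  (LinearMap.snd ℂ _ _).prod
    (-(M⁻¹.mulVecLin ∘ₗ (K.mulVecLin ∘ₗ LinearMap.fst ℂ _ _ + D.mulVecLin ∘ₗ LinearMap.snd ℂ _ _)))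

theorem firstOrderGenerator_apply (M D K : Matrix N N ℂ) (x v : N → ℂ) :
    firstOrderGenerator M D K (x, v) = (v, -(M⁻¹ *ᵥ (K *ᵥ x + D *ᵥ v))) := rfl

theorem firstOrderGenerator_apply_of_eq_zero {M D K : Matrix N N ℂ} (hM : IsUnit M)
    {x v a : N → ℂ} (h : M *ᵥ a + D *ᵥ v + K *ᵥ x = 0) :
    firstOrderGenerator M D K (x, v) = (v, a) := by
  have hMa : M *ᵥ a = -(K *ᵥ x + D *ᵥ v) := by
    rw [eq_neg_iff_add_eq_zero, ← h]
    abel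
  rw [firstOrderGenerator_apply, ← mulVec_neg, ← hMa, mulVec_mulVec,
    nonsing_inv_mul _ ((isUnit_iff_isUnit_det _).1 hM), one_mulVec]

theorem exists_quadratic_mulVec_eq_zero_of_hasEigenvalue {M D K : Matrix N N ℂ} (hM : IsUnit M)
    {l : ℂ} (hl : (firstOrderGenerator M D K).HasEigenvalue l) :
    ∃ u ≠ 0, l ^ 2 • (M *ᵥ u) + l • (D *ᵥ u) + K *ᵥ u = 0 := by
  obtain ⟨⟨u, v⟩, huv⟩ := hl.exists_hasEigenvector
  have happ := huv.apply_eq_smul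
  rw [firstOrderGenerator_apply, Prod.smul_mk, Prod.mk.injEq] at happ
  obtain ⟨rfl, hv⟩ := happ
  refine ⟨u, fun hu => huv.2 (by simp [hu]), ?_⟩
  have h := congrArg (M *ᵥ ·) hv
  simp only [mulVec_neg, mulVec_mulVec, mul_nonsing_inv _ ((isUnit_iff_isUnit_det _).1 hM),
    one_mulVec, mulVec_smul, smul_smul, ← pow_two] at h
  rw [← h]
  abel

end FirstOrderGenerator

theorem tendsto_zero_of_isPervasivelyDamped_complex {M D K : Matrix N N ℂ} (hM : M.PosDef)
    (hD : D.PosSemidef) (hK : K.PosDef) (hdamp : IsPervasivelyDamped M D K) {x v a : ℝ → N → ℂ}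
    (hx : ∀ t, 0 ≤ t → HasDerivWithinAt x (v t) (Ici 0) t)
    (hv : ∀ t, 0 ≤ t → HasDerivWithinAt v (a t) (Ici 0) t)
    (heq : ∀ t, 0 ≤ t → M *ᵥ a t + D *ᵥ v t + K *ᵥ x t = 0) :
    Tendsto x atTop (𝓝 0) := by
  classical
  have hlim : Tendsto (fun t => (x t, v t)) atTop (𝓝 0) := by
    refine tendsto_zero_of_forall_hasEigenvalue_re_neg (A := firstOrderGenerator M D K)
      (fun l hl => ?_) (fun t ht => ?_)
    · obtain ⟨u, hu, hquad⟩ := exists_quadratic_mulVec_eq_zero_of_hasEigenvalue hM.isUnit hl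
      exact re_neg_of_quadratic_mulVec_eq_zero hM hD hK hdamp hu hquad
    · rw [firstOrderGenerator_apply_of_eq_zero hM.isUnit (heq t ht)]
      exact (hx t ht).prodMk (hv t ht)
  exact (continuous_fst.tendsto _).comp hlim

theorem tendsto_zero_of_isPervasivelyDamped {M D K : Matrix N N ℝ} (hM : M.PosDef)
    (hD : D.PosSemidef) (hK : K.PosDef) (hdamp : IsPervasivelyDamped M D K) {x v a : ℝ → N → ℝ}
    (hx : ∀ t, 0 ≤ t → HasDerivWithinAt x (v t) (Ici 0) t)
    (hv : ∀ t, 0 ≤ t → HasDerivWithinAt v (a t) (Ici 0) t)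
    (heq : ∀ t, 0 ≤ t → M *ᵥ a t + D *ᵥ v t + K *ᵥ x t = 0) :
    Tendsto x atTop (𝓝 0) := by
  have hderiv {z : ℝ → N → ℝ} {z' : N → ℝ} {t : ℝ} (hz : HasDerivWithinAt z z' (Ici 0) t) :
      HasDerivWithinAt (fun t i => (z t i : ℂ)) (fun i => (z' i : ℂ)) (Ici 0) t :=
    hasDerivWithinAt_pi.2 fun i => (hasDerivWithinAt_pi.1 hz i).ofReal_comp
  have hmap (A : Matrix N N ℝ) (z : N → ℝ) :
      A.map ((↑) : ℝ → ℂ) *ᵥ (fun i => (z i : ℂ)) = fun i => ((A *ᵥ z) i : ℂ) :=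
    funext fun i => (Complex.ofRealHom.map_mulVec A z i).symm
  have hlim := tendsto_zero_of_isPervasivelyDamped_complex (posDef_map_ofReal hM)
    (posSemidef_map_ofReal hD) (posDef_map_ofReal hK) hdamp.map_ofReal
    (fun t ht => hderiv (hx t ht)) (fun t ht => hderiv (hv t ht)) fun t ht => funext fun i => by
      simpa [hmap] using congrArg ((↑) : ℝ → ℂ) (congrFun (heq t ht) i)
  refine tendsto_pi_nhds.2 fun i => ?_
  simpa [comp_def] using (Complex.continuous_re.tendsto _).comp (tendsto_pi_nhds.1 hlim i)

end PervasiveDamping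

section Perturbation

variable {N : Type*} [Fintype N] {M D K R : Matrix N N ℝ}

theorem exists_norm_eq_one_of_not_isPervasivelyDamped (h : ¬ IsPervasivelyDamped M D K) :
    ∃ (u : N → ℝ) (μ : ℝ), ‖u‖ = 1 ∧ K *ᵥ u = μ • (M *ᵥ u) ∧ D *ᵥ u = 0 := by
  simp only [IsPervasivelyDamped, not_forall] at h
  obtain ⟨u, μ, hK, hD, hu⟩ := h
  refine ⟨‖u‖⁻¹ • u, μ, norm_smul_inv_norm hu, ?_, ?_⟩
  · rw [mulVec_smul, mulVec_smul, hK, smul_comm]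
  · rw [mulVec_smul, hD, smul_zero]

theorem exists_tendsto_of_frequently_not_isPervasivelyDamped
    (h : ∃ᶠ ε in 𝓝[>] (0 : ℝ), ¬ IsPervasivelyDamped M D (K + ε • R)) :
    ∃ (ε μ : ℕ → ℝ) (u : ℕ → N → ℝ) (u₀ : N → ℝ), Tendsto ε atTop (𝓝[>] 0) ∧
      Tendsto u atTop (𝓝 u₀) ∧ u₀ ≠ 0 ∧
      ∀ k, (K + ε k • R) *ᵥ u k = μ k • (M *ᵥ u k) ∧ D *ᵥ u k = 0 := by
  obtain ⟨ε, hε, hnot⟩ := exists_seq_forall_of_frequently h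
  choose u μ hu hmode using fun k => exists_norm_eq_one_of_not_isPervasivelyDamped (hnot k)
  obtain ⟨u₀, hu₀, φ, hφ, hlim⟩ := (isCompact_sphere (0 : N → ℝ) 1).tendsto_subseq
    fun k => mem_sphere_zero_iff_norm.2 (hu k)
  exact ⟨ε ∘ φ, μ ∘ φ, u ∘ φ, u₀, hε.comp hφ.tendsto_atTop, hlim,
    ne_zero_of_mem_unit_sphere ⟨u₀, hu₀⟩, fun k => hmode (φ k)⟩

theorem eq_rayleighQuotient (hM : M.PosDef) {u : N → ℝ} (hu : u ≠ 0) {μ : ℝ}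
    (h : K *ᵥ u = μ • (M *ᵥ u)) : μ = u ⬝ᵥ K *ᵥ u / u ⬝ᵥ M *ᵥ u := by
  have hpos : 0 < u ⬝ᵥ M *ᵥ u := hM.dotProduct_mulVec_pos hu
  rw [h, dotProduct_smul, smul_eq_mul, mul_div_cancel_right₀ _ hpos.ne']

theorem mulVec_eq_rayleighQuotient_smul_of_tendsto {ι : Type*} {f : Filter ι} [f.NeBot]
    (hM : M.PosDef) {A : ι → Matrix N N ℝ} {μ : ι → ℝ} {u : ι → N → ℝ} {u₀ : N → ℝ}
    (hA : Tendsto A f (𝓝 K)) (hu : Tendsto u f (𝓝 u₀)) (hu₀ : u₀ ≠ 0)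
    (h : ∀ k, A k *ᵥ u k = μ k • (M *ᵥ u k)) :
    K *ᵥ u₀ = (u₀ ⬝ᵥ K *ᵥ u₀ / u₀ ⬝ᵥ M *ᵥ u₀) • (M *ᵥ u₀) := by
  have hAu : Tendsto (fun k => A k *ᵥ u k) f (𝓝 (K *ᵥ u₀)) :=
    ((continuous_fst.matrix_mulVec continuous_snd).tendsto (K, u₀)).comp (hA.prodMk_nhds hu)
  have hMu : Tendsto (fun k => M *ᵥ u k) f (𝓝 (M *ᵥ u₀)) :=
    ((continuous_const.matrix_mulVec continuous_id).tendsto u₀).comp hu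
  have hdot {z : ι → N → ℝ} {z₀ : N → ℝ} (hz : Tendsto z f (𝓝 z₀)) :
      Tendsto (fun k => u k ⬝ᵥ z k) f (𝓝 (u₀ ⬝ᵥ z₀)) :=
    ((continuous_fst.dotProduct continuous_snd).tendsto (u₀, z₀)).comp (hu.prodMk_nhds hz)
  have hpos : 0 < u₀ ⬝ᵥ M *ᵥ u₀ := hM.dotProduct_mulVec_pos hu₀
  have hμ : Tendsto μ f (𝓝 (u₀ ⬝ᵥ K *ᵥ u₀ / u₀ ⬝ᵥ M *ᵥ u₀)) :=
    ((hdot hAu).div (hdot hMu) hpos.ne').congr' <| by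
      filter_upwards [hu.eventually_ne hu₀] with k hk
      exact (eq_rayleighQuotient hM hk (h k)).symm
  exact tendsto_nhds_unique (hAu.congr h) (hμ.smul hMu)

/- Pairing `(K + ε R) u = μ M u` with `w` removes the zeroth order terms. -/
theorem mul_dotProduct_mulVec_eq_of_mode (hM : M.IsHermitian) (hK : K.IsHermitian) {ε μ μ₀ : ℝ}
    {u w : N → ℝ} (hu : (K + ε • R) *ᵥ u = μ • (M *ᵥ u)) (hw : K *ᵥ w = μ₀ • (M *ᵥ w)) :
    ε * (w ⬝ᵥ R *ᵥ u) = (μ - μ₀) * (w ⬝ᵥ M *ᵥ u) := by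
  have hsymm {A : Matrix N N ℝ} (hA : A.IsHermitian) : w ⬝ᵥ A *ᵥ u = u ⬝ᵥ A *ᵥ w := by
    rw [dotProduct_mulVec, ← mulVec_transpose, ← conjTranspose_eq_transpose_of_trivial, hA.eq,
      dotProduct_comm]
  have h := congrArg (w ⬝ᵥ ·) hu
  simp only [add_mulVec, smul_mulVec, dotProduct_add, dotProduct_smul, smul_eq_mul, hsymm hK, hw,
    ← hsymm hM] at h
  linear_combination h

theorem dotProduct_mulVec_mul_comm_of_tendsto {ι : Type*} {f : Filter ι} [f.NeBot]
    (hM : M.IsHermitian) (hK : K.IsHermitian) {ε μ : ι → ℝ} {μ₀ : ℝ} {u : ι → N → ℝ}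
    {u₀ w w' : N → ℝ} (hε : ∀ᶠ k in f, ε k ≠ 0) (hlim : Tendsto u f (𝓝 u₀))
    (hu : ∀ k, (K + ε k • R) *ᵥ u k = μ k • (M *ᵥ u k))
    (hw : K *ᵥ w = μ₀ • (M *ᵥ w)) (hw' : K *ᵥ w' = μ₀ • (M *ᵥ w')) :
    (w ⬝ᵥ R *ᵥ u₀) * (w' ⬝ᵥ M *ᵥ u₀) = (w' ⬝ᵥ R *ᵥ u₀) * (w ⬝ᵥ M *ᵥ u₀) := by
  have hdot (z : N → ℝ) (A : Matrix N N ℝ) :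
      Tendsto (fun k => z ⬝ᵥ A *ᵥ u k) f (𝓝 (z ⬝ᵥ A *ᵥ u₀)) :=
    ((continuous_const.dotProduct (continuous_const.matrix_mulVec continuous_id)).tendsto
      u₀).comp hlim
  refine tendsto_nhds_unique_of_eventuallyEq ((hdot w R).mul (hdot w' M))
    ((hdot w' R).mul (hdot w M)) ?_
  filter_upwards [hε] with k hk
  have h := mul_dotProduct_mulVec_eq_of_mode hM hK (hu k) hw
  have h' := mul_dotProduct_mulVec_eq_of_mode hM hK (hu k) hw'
  refine mul_left_cancel₀ hk ?_
  linear_combination (w' ⬝ᵥ M *ᵥ u k) * h - (w ⬝ᵥ M *ᵥ u k) * h'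

theorem exists_mode_of_frequently_not_isPervasivelyDamped (hM : M.PosDef) (hK : K.IsHermitian)
    (h : ∃ᶠ ε in 𝓝[>] (0 : ℝ), ¬ IsPervasivelyDamped M D (K + ε • R)) :
    ∃ (u : N → ℝ) (μ ν : ℝ), u ≠ 0 ∧ D *ᵥ u = 0 ∧ K *ᵥ u = μ • (M *ᵥ u) ∧
      ∀ w, K *ᵥ w = μ • (M *ᵥ w) → w ⬝ᵥ R *ᵥ u = ν * (w ⬝ᵥ M *ᵥ u) := by
  obtain ⟨ε, μ, u, u₀, hε, hlim, hu₀, hu⟩ :=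
    exists_tendsto_of_frequently_not_isPervasivelyDamped h
  have hpos : 0 < u₀ ⬝ᵥ M *ᵥ u₀ := hM.dotProduct_mulVec_pos hu₀
  have hKε : Tendsto (fun k => K + ε k • R) atTop (𝓝 K) := by
    simpa using (hε.mono_right nhdsWithin_le_nhds).smul_const R |>.const_add K
  have hD : D *ᵥ u₀ = 0 := by
    refine tendsto_nhds_unique
      (((continuous_const.matrix_mulVec continuous_id).tendsto u₀).comp hlim) ?_
    exact tendsto_const_nhds.congr fun k => (hu k).2.symm
  have hKu₀ := mulVec_eq_rayleighQuotient_smul_of_tendsto hM hKε hlim hu₀ fun k => (hu k).1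
  refine ⟨u₀, _, u₀ ⬝ᵥ R *ᵥ u₀ / u₀ ⬝ᵥ M *ᵥ u₀, hu₀, hD, hKu₀, fun w hw => ?_⟩
  rw [div_mul_eq_mul_div, eq_div_iff hpos.ne']
  exact dotProduct_mulVec_mul_comm_of_tendsto hM.isHermitian hK
    ((hε.eventually eventually_mem_nhdsWithin).mono fun k hk => ne_of_gt hk) hlim
    (fun k => (hu k).1) hw hKu₀

end Perturbation

section EigenvalueMultiplicity

variable {F ι N : Type*} [Field F] [Fintype N] [DecidableEq N]

theorem map_eigenvalues_le_roots_charpoly [Fintype ι] {A : Matrix N N F} {v : ι → N → F}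
    {μ : ι → F} (hv : LinearIndependent F v) (h : ∀ i, A *ᵥ v i = μ i • v i) :
    Finset.univ.val.map μ ≤ A.charpoly.roots := by
  classical
  rw [Multiset.le_iff_count]
  intro l
  let w (i : {i // l = μ i}) : Module.End.eigenspace (toLin' A) l :=
    ⟨v i, by rw [Module.End.mem_eigenspace_iff, toLin'_apply, h, ← i.2]⟩
  have hw : LinearIndependent F w :=
    .of_comp (Submodule.subtype _) (hv.comp _ Subtype.val_injective)
  calc (Finset.univ.val.map μ).count l = Fintype.card {i // l = μ i} := by
        rw [Multiset.count_map, Fintype.card_subtype]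
        rfl
    _ ≤ Module.finrank F (Module.End.eigenspace (toLin' A) l) := hw.fintype_card_le_finrank
    _ ≤ (toLin' A).charpoly.rootMultiplicity l := LinearMap.finrank_eigenspace_le _ _
    _ = A.charpoly.roots.count l := by rw [charpoly_toLin', Polynomial.count_roots]

theorem injective_eigenvalues_of_nodup_roots_charpoly [Finite ι] {A : Matrix N N F}
    (hA : A.charpoly.roots.Nodup) {v : ι → N → F} {μ : ι → F} (hv : LinearIndependent F v)
    (h : ∀ i, A *ᵥ v i = μ i • v i) : Injective μ := by
  have := Fintype.ofFinite ι
  have hnodup := Multiset.nodup_of_le (map_eigenvalues_le_roots_charpoly hv h) hA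
  intro i j hij
  exact Multiset.inj_on_of_nodup_map hnodup i (Finset.mem_univ i) j (Finset.mem_univ j) hij

end EigenvalueMultiplicity

theorem getElem_le_of_lt_countP {α : Type*} [LinearOrder α] {L : List α}
    (hL : L.Pairwise (· ≤ ·)) {c : α} {k : ℕ}
    (hk : k < L.length) (hcount : k < L.countP (· ≤ c)) : L[k] ≤ c := by
  by_contra! hc
  have hdrop : (L.drop k).countP (· ≤ c) = 0 := by
    simp only [List.countP_eq_zero, decide_eq_true_eq, not_le]
    intro b hb
    obtain ⟨i, hi, rfl⟩ := List.mem_iff_getElem.1 hb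
    rw [List.getElem_drop]
    exact hc.trans_le (hL.rel_get_of_le (a := ⟨k, hk⟩) (b := ⟨k + i, by grind⟩) (by simp))
  have htake := (L.take k).countP_le_length (p := (· ≤ c))
  rw [← List.take_append_drop k L, List.countP_append, hdrop] at hcount
  rw [List.length_take] at htake
  omega

theorem reEigenvalue_le_of_linearIndependent {m k : ℕ} {X : Matrix (Fin m) (Fin m) ℂ} {c : ℝ}
    {v : Fin (k + 1) → Fin m → ℂ} {μ : Fin (k + 1) → ℂ} (hv : LinearIndependent ℂ v)
    (h : ∀ i, X *ᵥ v i = μ i • v i) (hμ : ∀ i, (μ i).re ≤ c) (hk : k < m) :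
    reEigenvalue X ⟨k, hk⟩ ≤ c := by
  refine getElem_le_of_lt_countP (Multiset.pairwise_sort _ _) _ ?_
  rw [← Multiset.coe_countP, Multiset.sort_eq]
  have hre : ∀ b ∈ (Finset.univ.val.map μ).map Complex.re, b ≤ c := by
    simpa only [Multiset.map_map, Multiset.mem_map, Finset.mem_val, Finset.mem_univ, true_and,
      Function.comp_apply, forall_exists_index, forall_apply_eq_imp_iff] using hμ
  calc k < ((Finset.univ.val.map μ).map Complex.re).card := by simp
    _ = ((Finset.univ.val.map μ).map Complex.re).countP (· ≤ c) :=
      (Multiset.countP_eq_card.2 hre).symm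
    _ ≤ (X.charpoly.roots.map Complex.re).countP (· ≤ c) :=
      Multiset.countP_le_of_le _ (Multiset.map_le_map (map_eigenvalues_le_roots_charpoly hv h))

theorem pencilPoly_eq {n : ℕ} {M : Matrix (Fin n) (Fin n) ℝ} (hM : IsUnit M.det)
    (K : Matrix (Fin n) (Fin n) ℝ) :
    pencilPoly M K = Polynomial.C M.det * (M⁻¹ * K).charpoly := by
  rw [pencilPoly, charpoly, charmatrix, RingHom.map_det, ← det_mul, mul_sub,
    RingHom.mapMatrix_apply, RingHom.mapMatrix_apply, ← Matrix.map_mul,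
    mul_nonsing_inv_cancel_left _ _ hM, scalar_apply, ← smul_eq_mul_diagonal]

theorem inv_mul_mulVec_eq_smul {S N : Type*} [CommRing S] [Fintype N] [DecidableEq N]
    {M K : Matrix N N S} (hM : IsUnit M.det) {μ : S} {u : N → S} (h : K *ᵥ u = μ • (M *ᵥ u)) :
    (M⁻¹ * K) *ᵥ u = μ • u := by
  rw [← mulVec_mulVec, h, mulVec_smul, mulVec_mulVec, nonsing_inv_mul _ hM, one_mulVec]

theorem exists_smul_of_pencil_eigenvector {n : ℕ} {M K : Matrix (Fin n) (Fin n) ℝ}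
    (hM : IsUnit M.det) (hdistinct : (pencilPoly M K).roots.Nodup) {μ : ℝ} {v w : Fin n → ℝ}
    (hv0 : v ≠ 0) (hv : K *ᵥ v = μ • (M *ᵥ v)) (hw : K *ᵥ w = μ • (M *ᵥ w)) :
    ∃ c : ℝ, c • v = w := by
  by_contra! hc
  rw [pencilPoly_eq hM, Polynomial.roots_C_mul _ hM.ne_zero] at hdistinct
  have hinj := injective_eigenvalues_of_nodup_roots_charpoly (μ := fun _ => μ) hdistinct
    ((LinearIndependent.pair_iff' hv0).2 hc) (Fin.forall_fin_two.2
      ⟨inv_mul_mulVec_eq_smul hM hv, inv_mul_mulVec_eq_smul hM hw⟩)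
  exact absurd (hinj (a₁ := 0) (a₂ := 1) rfl) (by decide)

section Kronecker

variable {S ι ι' κ κ' : Type*} [CommRing S]

theorem kronecker_mulVec_uncurry [Fintype ι'] [Fintype κ'] (A : Matrix ι ι' S) (B : Matrix κ κ' S)
    (z : ι' → κ' → S) :
    (A ⊗ₖ B) *ᵥ uncurry z = uncurry fun i => ∑ j, A i j • (B *ᵥ z j) := by
  ext ⟨i, a⟩
  simp [mulVec, dotProduct, Fintype.sum_prod_type, Finset.mul_sum, mul_assoc]

theorem one_kronecker_mulVec_uncurry [Fintype ι] [DecidableEq ι] [Fintype κ'] (B : Matrix κ κ' S)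
    (z : ι → κ' → S) : ((1 : Matrix ι ι S) ⊗ₖ B) *ᵥ uncurry z = uncurry fun i => B *ᵥ z i := by
  simp [kronecker_mulVec_uncurry, one_apply]

theorem kronecker_mulVec_uncurry_smul [Fintype ι'] [Fintype κ'] (A : Matrix ι ι' S)
    (B : Matrix κ κ' S) (γ : ι' → S) (v : κ' → S) :
    (A ⊗ₖ B) *ᵥ uncurry (fun j => γ j • v) = uncurry fun i => (A *ᵥ γ) i • (B *ᵥ v) := by
  simp only [kronecker_mulVec_uncurry, mulVec_smul, smul_smul, ← Finset.sum_smul]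
  rfl

theorem uncurry_smul_dotProduct_uncurry_smul [Fintype ι] [Fintype κ] (β γ : ι → S) (v w : κ → S) :
    uncurry (fun i => β i • v) ⬝ᵥ uncurry (fun i => γ i • w) = (β ⬝ᵥ γ) * (v ⬝ᵥ w) := by
  simp only [dotProduct, Fintype.sum_prod_type, Finset.sum_mul_sum]
  refine Finset.sum_congr rfl fun i _ => Finset.sum_congr rfl fun a _ => ?_
  simp only [uncurry_apply_pair, Pi.smul_apply, smul_eq_mul]
  ring

theorem eq_zero_of_uncurry_smul_eq_zero [NoZeroDivisors S] {γ : ι → S} {v : κ → S} (hv : v ≠ 0)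
    (h : uncurry (fun i => γ i • v) = 0) : γ = 0 :=
  funext fun i => (smul_eq_zero.1 (funext fun a => congrFun h (i, a))).resolve_right hv

theorem mulVec_eq_smul_of_forall_uncurry_smul_dotProduct {S ι κ : Type*} [Field S] [Fintype ι]
    [DecidableEq ι] [Fintype κ] {L : Matrix ι ι S} {H M : Matrix κ κ S} {γ : ι → S} {v : κ → S}
    {ν : S} (hv : v ⬝ᵥ H *ᵥ v ≠ 0)
    (h : ∀ β : ι → S, uncurry (fun i => β i • v) ⬝ᵥ (L ⊗ₖ H) *ᵥ uncurry (fun i => γ i • v) =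
      ν * (uncurry (fun i => β i • v) ⬝ᵥ
        ((1 : Matrix ι ι S) ⊗ₖ M) *ᵥ uncurry (fun i => γ i • v))) :
    L *ᵥ γ = (ν * (v ⬝ᵥ M *ᵥ v) / (v ⬝ᵥ H *ᵥ v)) • γ := by
  refine dotProduct_eq _ _ fun β => ?_
  have hβ := h β
  rw [kronecker_mulVec_uncurry_smul, kronecker_mulVec_uncurry_smul, one_mulVec,
    uncurry_smul_dotProduct_uncurry_smul, uncurry_smul_dotProduct_uncurry_smul] at hβ
  rw [dotProduct_comm, smul_dotProduct, dotProduct_comm γ, smul_eq_mul, div_mul_eq_mul_div,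
    eq_div_iff hv]
  linear_combination hβ

end Kronecker

theorem mulVec_eq_zero_of_add_mulVec_eq_zero {N 𝕜 : Type*} [Fintype N] [RCLike 𝕜]
    {A B : Matrix N N 𝕜} (hA : A.PosSemidef) (hB : B.PosSemidef) {u : N → 𝕜}
    (h : (A + B) *ᵥ u = 0) : A *ᵥ u = 0 ∧ B *ᵥ u = 0 := by
  rw [← hA.dotProduct_mulVec_zero_iff, ← hB.dotProduct_mulVec_zero_iff,
    ← add_eq_zero_iff_of_nonneg (hA.dotProduct_mulVec_nonneg u) (hB.dotProduct_mulVec_nonneg u),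
    ← dotProduct_add, ← add_mulVec, h, dotProduct_zero]

section Laplacian

variable {q : ℕ} {w : Fin q → Fin q → ℝ}

theorem lap_eq (hdiag : ∀ i, w i i = 0) : lap w = diagonal (fun i => ∑ k, w i k) - of w := by
  ext i j
  by_cases h : i = j
  · subst h
    simp [lap, hdiag]
  · simp [lap, h]

theorem lap_mulVec (hdiag : ∀ i, w i i = 0) (x : Fin q → ℝ) (i : Fin q) :
    (lap w *ᵥ x) i = ∑ j, w i j * (x i - x j) := by
  rw [lap_eq hdiag, sub_mulVec, Pi.sub_apply, mulVec_diagonal, Finset.sum_mul]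
  simp [mulVec, dotProduct, mul_sub]

theorem lap_isHermitian (hsymm : ∀ i j, w i j = w j i) : (lap w).IsHermitian := by
  ext i j
  by_cases h : i = j
  · subst h
    rfl
  · simp [lap, h, Ne.symm h, hsymm i j]

theorem two_mul_dotProduct_lap_mulVec (hsymm : ∀ i j, w i j = w j i) (hdiag : ∀ i, w i i = 0)
    (x : Fin q → ℝ) : 2 * (x ⬝ᵥ lap w *ᵥ x) = ∑ i, ∑ j, w i j * (x i - x j) ^ 2 := by
  have h : x ⬝ᵥ lap w *ᵥ x = ∑ i, ∑ j, w i j * (x i * (x i - x j)) := by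
    simp only [dotProduct, lap_mulVec hdiag, Finset.mul_sum, mul_left_comm]
  have hswap : x ⬝ᵥ lap w *ᵥ x = ∑ i, ∑ j, w i j * (x j * (x j - x i)) := by
    rw [h, Finset.sum_comm]
    simp only [hsymm]
  rw [two_mul]
  nth_rewrite 1 [h]
  rw [hswap]
  simp only [← Finset.sum_add_distrib]
  exact Finset.sum_congr rfl fun i _ => Finset.sum_congr rfl fun j _ => by ring

theorem lap_posSemidef (hnonneg : ∀ i j, 0 ≤ w i j) (hsymm : ∀ i j, w i j = w j i)
    (hdiag : ∀ i, w i i = 0) : (lap w).PosSemidef := by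
  refine PosSemidef.of_dotProduct_mulVec_nonneg (lap_isHermitian hsymm) fun x => ?_
  refine nonneg_of_mul_nonneg_right (a := 2) ?_ two_pos
  rw [star_trivial, two_mul_dotProduct_lap_mulVec hsymm hdiag]
  exact Finset.sum_nonneg fun i _ => Finset.sum_nonneg fun j _ =>
    mul_nonneg (hnonneg i j) (sq_nonneg _)

theorem lap_kronecker_mulVec_uncurry {n : ℕ} (hdiag : ∀ i, w i i = 0)
    (B : Matrix (Fin n) (Fin n) ℝ) (z : Fin q → Fin n → ℝ) :
    (lap w ⊗ₖ B) *ᵥ uncurry z = uncurry fun i => ∑ j, (w i j • B) *ᵥ (z i - z j) := by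
  rw [kronecker_mulVec_uncurry]
  congr 1
  ext i a
  simpa [mulVec, dotProduct, smul_mulVec, Finset.sum_apply, mul_sub, mulVec_sub]
    using lap_mulVec hdiag (fun j => (B *ᵥ z j) a) i

theorem complexCombine_mulVec_ofReal (X Y : Matrix (Fin q) (Fin q) ℝ) (x : Fin q → ℝ) :
    complexCombine X Y *ᵥ (fun i => (x i : ℂ)) =
      fun i => ((X *ᵥ x) i : ℂ) + Complex.I * ((Y *ᵥ x) i : ℂ) := by
  funext i
  rw [complexCombine, add_mulVec, smul_mulVec]
  exact congrArg₂ (fun a b => a + Complex.I * b)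
    (Complex.ofRealHom.map_mulVec X x i).symm (Complex.ofRealHom.map_mulVec Y x i).symm

theorem linearIndependent_one_of_sum_eq_zero {F ι : Type*} [Field F] [CharZero F] [Fintype ι]
    {γ : ι → F} (hγ : γ ≠ 0) (hsum : ∑ i, γ i = 0) : LinearIndependent F ![1, γ] := by
  obtain ⟨i, -⟩ := Function.ne_iff.1 hγ
  have : Nonempty ι := ⟨i⟩
  refine (LinearIndependent.pair_iff' one_ne_zero).2 ?_
  rintro c rfl
  have hc : c = 0 := by simpa using hsum
  exact hγ (by rw [hc, zero_smul])

theorem reEigenvalue_complexCombine_lap_nonpos (hq : 1 < q) {d r : Fin q → Fin q → ℝ}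
    (hd_diag : ∀ i, d i i = 0) (hr_diag : ∀ i, r i i = 0) {γ : Fin q → ℝ} {ν : ℝ} (hγ : γ ≠ 0)
    (hsum : ∑ i, γ i = 0) (hd : lap d *ᵥ γ = 0) (hr : lap r *ᵥ γ = ν • γ) :
    reEigenvalue (complexCombine (lap d) (lap r)) ⟨1, hq⟩ ≤ 0 := by
  have hγ' : (fun i => (γ i : ℂ)) ≠ 0 := fun h =>
    hγ (funext fun i => Complex.ofReal_eq_zero.1 (congrFun h i))
  have hind := linearIndependent_one_of_sum_eq_zero hγ' (by exact_mod_cast hsum)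
  refine reEigenvalue_le_of_linearIndependent (μ := ![0, Complex.I * ν]) hind
    (Fin.forall_fin_two.2 ⟨?_, ?_⟩) (Fin.forall_fin_two.2 ⟨?_, ?_⟩) hq
  · have h := complexCombine_mulVec_ofReal (lap d) (lap r) fun _ => 1
    have hone (w : Fin q → Fin q → ℝ) (hw : ∀ i, w i i = 0) : (lap w *ᵥ fun _ => 1) = 0 :=
      funext fun i => by simp [lap_mulVec hw]
    ext i
    simpa [Pi.one_def, hone d hd_diag, hone r hr_diag] using congrFun h i
  · ext i
    simpa [hd, hr, mul_assoc] using congrFun (complexCombine_mulVec_ofReal (lap d) (lap r) γ) i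
  · simp
  · simp

end Laplacian

section MeanPinnedDamping

variable {n q : ℕ} {d : Fin q → Fin q → ℝ} {M G : Matrix (Fin n) (Fin n) ℝ}

/-- The damping of the stacked array, with the mean of the oscillators pinned: the coupling does not
act on the mean, so a damping of the mean by `M` is added. It vanishes on velocities of mean zero,
and thus does not affect the deviations from the mean. -/
def meanPinnedDamping (d : Fin q → Fin q → ℝ) (M G : Matrix (Fin n) (Fin n) ℝ) :
    Matrix (Fin q × Fin n) (Fin q × Fin n) ℝ :=
  lap d ⊗ₖ G + vecMulVec 1 1 ⊗ₖ M

theorem posSemidef_vecMulVec_one_one_kronecker (hM : M.PosSemidef) :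
    ((vecMulVec 1 1 : Matrix (Fin q) (Fin q) ℝ) ⊗ₖ M).PosSemidef :=
  (posSemidef_vecMulVec_self_star 1).kronecker hM

theorem meanPinnedDamping_posSemidef (hd : (lap d).PosSemidef) (hM : M.PosSemidef)
    (hG : G.PosSemidef) : (meanPinnedDamping d M G).PosSemidef :=
  (hd.kronecker hG).add (posSemidef_vecMulVec_one_one_kronecker hM)

theorem meanPinnedDamping_mulVec_uncurry_of_sum_eq_zero {z : Fin q → Fin n → ℝ}
    (hz : ∑ i, z i = 0) :
    meanPinnedDamping d M G *ᵥ uncurry z = (lap d ⊗ₖ G) *ᵥ uncurry z := by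
  rw [meanPinnedDamping, add_mulVec, add_eq_left]
  ext ⟨i, b⟩
  simp [kronecker_mulVec_uncurry, ← mulVec_sum, hz]

theorem lap_mulVec_eq_zero_of_meanPinnedDamping_mulVec_eq_zero (hd : (lap d).PosSemidef)
    (hM : M.PosSemidef) (hG : G.PosSemidef) {γ : Fin q → ℝ} {v : Fin n → ℝ} (hMv : M *ᵥ v ≠ 0)
    (hGv : G *ᵥ v ≠ 0) (h : meanPinnedDamping d M G *ᵥ uncurry (fun i => γ i • v) = 0) :
    lap d *ᵥ γ = 0 ∧ ∑ i, γ i = 0 := by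
  obtain ⟨hlap, hmean⟩ := mulVec_eq_zero_of_add_mulVec_eq_zero (hd.kronecker hG)
    (posSemidef_vecMulVec_one_one_kronecker hM) h
  rw [kronecker_mulVec_uncurry_smul] at hlap hmean
  refine ⟨eq_zero_of_uncurry_smul_eq_zero hGv hlap, ?_⟩
  have hone := eq_zero_of_uncurry_smul_eq_zero hMv hmean
  rcases isEmpty_or_nonempty (Fin q) with _ | ⟨⟨i⟩⟩
  · simp
  · simpa only [vecMulVec_mulVec, one_dotProduct, Pi.smul_apply, Pi.one_apply, Pi.zero_apply,
      MulOpposite.smul_eq_mul_unop, MulOpposite.unop_op, one_mul] using congrFun hone i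

end MeanPinnedDamping

theorem IsObservablePair.eq_zero_of_mulVec_eq_zero {m n : ℕ} {C : Matrix (Fin m) (Fin n) ℝ}
    {A : Matrix (Fin n) (Fin n) ℝ} (h : IsObservablePair C A) {μ : ℝ} {u : Fin n → ℝ}
    (hA : A *ᵥ u = μ • u) (hC : C *ᵥ u = 0) : u = 0 := by
  have hexp (t : ℝ) : HasDerivAt (fun t => Real.exp (μ * t)) (Real.exp (μ * t) * μ) t := by
    simpa using ((hasDerivAt_id t).const_mul μ).exp
  have hu : IsLinearTrajectory A fun t => Real.exp (μ * t) • u := fun t _ => by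
    rw [mulVec_smul, hA, smul_smul]
    exact ((hexp t).smul_const u).hasDerivWithinAt
  have hzero : IsLinearTrajectory A fun _ => 0 := fun t _ => by
    rw [mulVec_zero]
    exact hasDerivWithinAt_const _ _ _
  simpa using h _ _ hu hzero fun t _ => by rw [mulVec_smul, hC, smul_zero, mulVec_zero]

theorem IsObservablePair.isPervasivelyDamped {m n : ℕ} {C : Matrix (Fin m) (Fin n) ℝ}
    {M K : Matrix (Fin n) (Fin n) ℝ} (h : IsObservablePair C (M⁻¹ * K)) (hM : IsUnit M.det) :
    IsPervasivelyDamped M (Cᵀ * C) K := fun u μ hK hC => by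
  rw [← conjTranspose_eq_transpose_of_trivial, conjTranspose_mul_self_mulVec_eq_zero] at hC
  exact h.eq_zero_of_mulVec_eq_zero (inv_mul_mulVec_eq_smul hM hK) hC

section WeakCoupling

variable {n q : ℕ} {M K G H : Matrix (Fin n) (Fin n) ℝ} {d r : Fin q → Fin q → ℝ}

theorem exists_eq_uncurry_smul_of_mode (hM : IsUnit M.det)
    (hdistinct : (pencilPoly M K).roots.Nodup) {u : Fin q × Fin n → ℝ} (hu : u ≠ 0) {μ : ℝ}
    (h : ((1 : Matrix (Fin q) (Fin q) ℝ) ⊗ₖ K) *ᵥ u =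
      μ • (((1 : Matrix (Fin q) (Fin q) ℝ) ⊗ₖ M) *ᵥ u)) :
    ∃ (γ : Fin q → ℝ) (v : Fin n → ℝ), γ ≠ 0 ∧ v ≠ 0 ∧ K *ᵥ v = μ • (M *ᵥ v) ∧
      u = uncurry fun i => γ i • v := by
  obtain ⟨z, rfl⟩ : ∃ z, u = uncurry z := ⟨curry u, (uncurry_curry u).symm⟩
  rw [one_kronecker_mulVec_uncurry, one_kronecker_mulVec_uncurry] at h
  have hz (i : Fin q) : K *ᵥ z i = μ • (M *ᵥ z i) := funext fun a => congrFun h (i, a)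
  obtain ⟨i₀, hi₀⟩ : ∃ i, z i ≠ 0 := by
    by_contra! h0
    exact hu (funext fun p => congrFun (h0 p.1) p.2)
  choose γ hγ using fun i =>
    exists_smul_of_pencil_eigenvector hM hdistinct hi₀ (hz i₀) (hz i)
  refine ⟨γ, z i₀, ?_, hi₀, hz i₀, by simp only [hγ]⟩
  rintro rfl
  exact hi₀ (by rw [← hγ i₀, Pi.zero_apply, zero_smul])

/- A failure for arbitrarily small `ε` would leave a tensor mode `γ ⊗ v` for which `γ` is orthogonal
to the constants, in the kernel of `lap d`, and an eigenvector of `lap r`. -/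
theorem eventually_isPervasivelyDamped_kronecker (hq : 1 < q) (hM : M.PosDef) (hK : K.IsHermitian)
    (hdistinct : (pencilPoly M K).roots.Nodup) (hG : G.PosSemidef) (hH : H.PosSemidef)
    (hGdamp : IsPervasivelyDamped M G K) (hHdamp : IsPervasivelyDamped M H K)
    (hd : (lap d).PosSemidef) (hd_diag : ∀ i, d i i = 0) (hr_diag : ∀ i, r i i = 0)
    (hlambda : 0 < reEigenvalue (complexCombine (lap d) (lap r)) ⟨1, hq⟩) :
    ∀ᶠ ε in 𝓝[>] (0 : ℝ), IsPervasivelyDamped ((1 : Matrix (Fin q) (Fin q) ℝ) ⊗ₖ M)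
      (meanPinnedDamping d M G) (1 ⊗ₖ K + ε • (lap r ⊗ₖ H)) := by
  by_contra hnot
  have hK' : ((1 : Matrix (Fin q) (Fin q) ℝ) ⊗ₖ K).IsHermitian := by
    rw [IsHermitian, conjTranspose_kronecker, conjTranspose_one, hK.eq]
  obtain ⟨u, μ, ν, hu, hDu, hKu, hRu⟩ := exists_mode_of_frequently_not_isPervasivelyDamped
    (PosDef.one.kronecker hM) hK' (not_eventually.1 hnot)
  obtain ⟨γ, v, hγ, hv, hKv, rfl⟩ :=
    exists_eq_uncurry_smul_of_mode ((isUnit_iff_isUnit_det _).1 hM.isUnit) hdistinct hu hKu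
  have hMv : M *ᵥ v ≠ 0 := fun h => (hM.dotProduct_mulVec_pos hv).ne' (by rw [h, dotProduct_zero])
  have hGv : G *ᵥ v ≠ 0 := fun h => hv (hGdamp v μ hKv h)
  have hHv : v ⬝ᵥ H *ᵥ v ≠ 0 := fun h =>
    hv (hHdamp v μ hKv ((hH.dotProduct_mulVec_zero_iff v).1 h))
  obtain ⟨hdγ, hγsum⟩ := lap_mulVec_eq_zero_of_meanPinnedDamping_mulVec_eq_zero hd hM.posSemidef
    hG hMv hGv hDu
  have hKβv (β : Fin q → ℝ) : ((1 : Matrix (Fin q) (Fin q) ℝ) ⊗ₖ K) *ᵥ uncurry (fun i => β i • v) =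
      μ • (((1 : Matrix (Fin q) (Fin q) ℝ) ⊗ₖ M) *ᵥ uncurry fun i => β i • v) := by
    simp only [kronecker_mulVec_uncurry_smul, one_mulVec, hKv]
    ext ⟨i, b⟩
    simp [mul_left_comm]
  have hrγ := mulVec_eq_smul_of_forall_uncurry_smul_dotProduct hHv fun β => hRu _ (hKβv β)
  exact hlambda.not_ge
    (reEigenvalue_complexCombine_lap_nonpos hq hd_diag hr_diag hγ hγsum hdγ hrγ)

end WeakCoupling

section Synchronization

variable {n q : ℕ} {M K G H : Matrix (Fin n) (Fin n) ℝ}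
  {D R : Fin q → Fin q → Matrix (Fin n) (Fin n) ℝ}
  {d r : Fin q → Fin q → ℝ} {x v a : ℝ → Fin q → Fin n → ℝ}

/-- The states of the `q` oscillators relative to their mean. -/
noncomputable def subMean (z : Fin q → Fin n → ℝ) (i : Fin q) : Fin n → ℝ :=
  z i - (q : ℝ)⁻¹ • ∑ k, z k

theorem subMean_sub_subMean (z : Fin q → Fin n → ℝ) (i j : Fin q) :
    subMean z i - subMean z j = z i - z j :=
  sub_sub_sub_cancel_right _ _ _

theorem sum_subMean (z : Fin q → Fin n → ℝ) : ∑ i, subMean z i = 0 := by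
  rcases eq_or_ne q 0 with rfl | hq
  · simp
  · simp [subMean, ← Nat.cast_smul_eq_nsmul ℝ, hq]

theorem sum_sum_mulVec_sub_eq_zero (hD : ∀ i j, D i j = D j i) (z : Fin q → Fin n → ℝ) :
    ∑ i, ∑ j, D i j *ᵥ (z i - z j) = 0 := by
  simp only [mulVec_sub, Finset.sum_sub_distrib]
  rw [sub_eq_zero, Finset.sum_comm]
  simp only [hD]

theorem IsArraySolution.comp_subMean (hD : ∀ i j, D i j = D j i) (hR : ∀ i j, R i j = R j i)
    (h : IsArraySolution M K D R x v a) :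
    IsArraySolution M K D R (fun t => subMean (x t)) (fun t => subMean (v t))
      (fun t => subMean (a t)) := by
  have hderiv {z : ℝ → Fin q → Fin n → ℝ} {z' : Fin q → Fin n → ℝ} {t : ℝ}
      (hz : HasDerivWithinAt z z' (Ici 0) t) :
      HasDerivWithinAt (fun t => subMean (z t)) (subMean z') (Ici 0) t := by
    rw [hasDerivWithinAt_pi] at hz ⊢
    exact fun i => (hz i).sub ((HasDerivWithinAt.fun_sum fun k _ => hz k).fun_const_smul _)
  refine ⟨fun t ht => hderiv (h.hasDeriv_pos t ht), fun t ht => hderiv (h.hasDeriv_vel t ht),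
    fun t ht i => ?_⟩
  have hsum : M *ᵥ ∑ k, a t k + K *ᵥ ∑ k, x t k = 0 := by
    have hsum := Finset.sum_congr rfl fun k (_ : k ∈ Finset.univ) => h.equation t ht k
    simpa only [Finset.sum_add_distrib, sum_sum_mulVec_sub_eq_zero hD,
      sum_sum_mulVec_sub_eq_zero hR, ← mulVec_sum, add_zero, Finset.sum_const_zero] using hsum
  simp only [subMean_sub_subMean]
  rw [← h.equation t ht i]
  simp only [subMean, mulVec_sub, mulVec_smul]
  linear_combination (norm := module) (-(q : ℝ)⁻¹) • hsum

theorem IsArraySolution.kronecker_equation (hd_diag : ∀ i, d i i = 0) (hr_diag : ∀ i, r i i = 0)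
    (h : IsArraySolution M K (fun i j => d i j • G) (fun i j => r i j • H) x v a)
    {t : ℝ} (ht : 0 ≤ t) (hv : ∑ i, v t i = 0) :
    ((1 : Matrix (Fin q) (Fin q) ℝ) ⊗ₖ M) *ᵥ uncurry (a t) +
      meanPinnedDamping d M G *ᵥ uncurry (v t) +
      (1 ⊗ₖ K + lap r ⊗ₖ H) *ᵥ uncurry (x t) = 0 := by
  rw [meanPinnedDamping_mulVec_uncurry_of_sum_eq_zero hv, add_mulVec, one_kronecker_mulVec_uncurry,
    one_kronecker_mulVec_uncurry, lap_kronecker_mulVec_uncurry hd_diag,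
    lap_kronecker_mulVec_uncurry hr_diag]
  ext ⟨i, b⟩
  have hib := congrFun (h.equation t ht i) b
  simp only [Pi.add_apply, Pi.zero_apply, uncurry_apply_pair] at hib ⊢
  linear_combination hib

theorem synchronizes_of_isPervasivelyDamped (hM : M.PosDef) (hK : K.PosDef) (hG : G.PosSemidef)
    (hH : H.PosSemidef) (hd_nonneg : ∀ i j, 0 ≤ d i j) (hd_symm : ∀ i j, d i j = d j i)
    (hd_diag : ∀ i, d i i = 0) (hr_nonneg : ∀ i j, 0 ≤ r i j) (hr_symm : ∀ i j, r i j = r j i)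
    (hr_diag : ∀ i, r i i = 0)
    (hdamp : IsPervasivelyDamped ((1 : Matrix (Fin q) (Fin q) ℝ) ⊗ₖ M)
      (meanPinnedDamping d M G) (1 ⊗ₖ K + lap r ⊗ₖ H)) :
    Synchronizes M K (fun i j => d i j • G) (fun i j => r i j • H) := by
  intro x v a h i j
  have hd := lap_posSemidef hd_nonneg hd_symm hd_diag
  have hr := lap_posSemidef hr_nonneg hr_symm hr_diag
  have hsub := h.comp_subMean (fun i j => by rw [hd_symm]) (fun i j => by rw [hr_symm])
  have hderiv {z : ℝ → Fin q → Fin n → ℝ} {z' : Fin q → Fin n → ℝ} {t : ℝ}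
      (hz : HasDerivWithinAt z z' (Ici 0) t) :
      HasDerivWithinAt (fun t => uncurry (z t)) (uncurry z') (Ici 0) t :=
    hasDerivWithinAt_pi.2 fun p => hasDerivWithinAt_pi.1 (hasDerivWithinAt_pi.1 hz p.1) p.2
  have hlim := tendsto_zero_of_isPervasivelyDamped (PosDef.one.kronecker hM)
    (meanPinnedDamping_posSemidef hd hM.posSemidef hG)
    ((PosDef.one.kronecker hK).add_posSemidef (hr.kronecker hH)) hdamp
    (fun t ht => hderiv (hsub.hasDeriv_pos t ht)) (fun t ht => hderiv (hsub.hasDeriv_vel t ht))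
    (fun t ht => hsub.kronecker_equation hd_diag hr_diag ht (sum_subMean _))
  have hdiff : Tendsto (fun t => x t i - x t j) atTop (𝓝 0) := by
    refine tendsto_pi_nhds.2 fun b => ?_
    have hib := (tendsto_pi_nhds.1 hlim (i, b)).sub (tendsto_pi_nhds.1 hlim (j, b))
    simpa [← Pi.sub_apply, subMean_sub_subMean] using hib
  simpa using (((PiLp.continuous_toLp 2 fun _ : Fin n => ℝ).tendsto 0).comp hdiff).norm

end Synchronization

theorem mainTheorem4 {n q md mr : ℕ} (hq : 2 ≤ q)
    (M K : Matrix (Fin n) (Fin n) ℝ) (hM : M.PosDef) (hK : K.PosDef)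
    (hdistinct : (pencilPoly M K).roots.Nodup)
    (Cd : Matrix (Fin md) (Fin n) ℝ) (Cr : Matrix (Fin mr) (Fin n) ℝ)
    (d r : Fin q → Fin q → ℝ)
    (hd_nonneg : ∀ i j, 0 ≤ d i j) (hd_symm : ∀ i j, d i j = d j i) (hd_diag : ∀ i, d i i = 0)
    (hr_nonneg : ∀ i j, 0 ≤ r i j) (hr_symm : ∀ i j, r i j = r j i) (hr_diag : ∀ i, r i i = 0)
    (hlambda : 0 < reEigenvalue (complexCombine (lap d) (lap r)) ⟨1, hq⟩)
    (hobs_d : IsObservablePair Cd (M⁻¹ * K)) (hobs_r : IsObservablePair Cr (M⁻¹ * K)) :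
    ∃ ρ : ℝ, 0 < ρ ∧ ∀ ε : ℝ, 0 < ε → ε < ρ →
      Synchronizes M K (fun i j => d i j • (Cdᵀ * Cd))
        (fun i j => ε • (r i j • (Crᵀ * Cr))) := by
  have hMdet : IsUnit M.det := (isUnit_iff_isUnit_det _).1 hM.isUnit
  have hCd : (Cdᵀ * Cd).PosSemidef := posSemidef_conjTranspose_mul_self Cd
  have hCr : (Crᵀ * Cr).PosSemidef := posSemidef_conjTranspose_mul_self Cr
  have hdamp := eventually_isPervasivelyDamped_kronecker hq hM hK.isHermitian hdistinct hCd hCr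
    (hobs_d.isPervasivelyDamped hMdet) (hobs_r.isPervasivelyDamped hMdet)
    (lap_posSemidef hd_nonneg hd_symm hd_diag) hd_diag hr_diag hlambda
  obtain ⟨ρ, hρ, hdampρ⟩ := mem_nhdsGT_iff_exists_Ioo_subset.1 hdamp
  refine ⟨ρ, hρ, fun ε hε hερ => ?_⟩
  simp_rw [smul_comm ε]
  refine synchronizes_of_isPervasivelyDamped hM hK hCd (hCr.smul hε.le) hd_nonneg hd_symm hd_diag
    hr_nonneg hr_symm hr_diag ?_
  rw [kronecker_smul]
  exact hdampρ ⟨hε, hερ⟩
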